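/- Let $R$ be a finite-dimensional solvable Lie algebra over $\mathbb{C}$, let $N$ be its nilradical (the largest nilpotent ideal), and let $Q$ be a vector-space complement of $N$ in $R$, so that $R = N \oplus Q$ as vector spaces. Write $N^2 = [N,N]$. Assume that $N$ has maximal rank in the following sense: there exists a finite-dimensional complex solvable Lie algebra $S$ whose nilradical is isomorphic, as a Lie algebra, to $N$ and has a vector-space complement in $S$ of dimension $\dim (N/N^2)$. If $\dim Q < \dim (N/N^2)$, then $R$ has an outer derivation, that is, a derivation $D : R \to R$ which is not of the form $\operatorname{ad}_x$ for any $x \in R$. -/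

import Mathlib

universe u v

/-- The nilradical of a Lie algebra: the sum of all ideals that are nilpotent as Lie algebras
(for a finite-dimensional Lie algebra, its largest nilpotent ideal). Mathlib's
`LieAlgebra.maxNilpotentIdeal` is different: it asks the whole algebra to act nilpotently on the
ideal. -/
def lieNilradical (L : Type u) [LieRing L] [LieAlgebra ℂ L] : LieIdeal ℂ L :=
  sSup { I : LieIdeal ℂ L | LieRing.IsNilpotent I }

/-- The dimension of `N / N²`, where `N² = [N, N]`. -/
noncomputable def dimModSquare (N : Type u) [LieRing N] [LieAlgebra ℂ N] : ℕ :=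
  Module.finrank ℂ (N ⧸ ⁅(⊤ : LieIdeal ℂ N), (⊤ : LieIdeal ℂ N)⁆)

/-- `N` has maximal rank: there is a finite-dimensional complex solvable Lie algebra `S` whose
nilradical is isomorphic to `N` and has a complementary subspace of dimension `dim N / N²`. -/
def HasMaximalRank (N : Type u) [LieRing N] [LieAlgebra ℂ N] : Prop :=
  ∃ (S : Type v) (_ : LieRing S) (_ : LieAlgebra ℂ S),
    FiniteDimensional ℂ S ∧ LieAlgebra.IsSolvable S ∧
      Nonempty (N ≃ₗ⁅ℂ⁆ lieNilradical S) ∧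
      ∃ Q : Submodule ℂ S, IsCompl (lieNilradical S).toSubmodule Q ∧
        Module.finrank ℂ Q = dimModSquare N

/-! Suppose every derivation of `R` is inner, and put V = N/N², r = dim V. Derivations of N act on V
with image A in End V; an element of a solvable Lie algebra with nilradical N acts on V by zero
exactly when it lies in N, because a derivation of N that is nilpotent on V is nilpotent
(`ker_actionOnAb`).

Maximal rank makes A large. The algebra `S` acts on V by r dimensions of commuting operators, one of
which has r distinct eigenvalues, so A contains all diagonal matrices of some basis
(`exists_basis_lineProj_mem_range`). Being closed under commutators, A is then an associative
algebra (`exists_subalgebra_eq_range_onAb`).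

Inner derivations make `R` rigid. The semisimple parts of a Cartan subalgebra's action are
derivations, hence inner, so R = N + T with T abelian and every ad x, x ∈ T, a polynomial in one
semisimple ad t (`exists_torus_of_forall_inner`). Thus `R` acts on V through polynomials in the
image of t, in a space of dimension dim Q < r. The centralizer of that image in A cannot fit into so
small a space (`exists_commute_notMem`). An element X outside it lifts to a derivation of N
commuting with t (`exists_onAb_eq_of_commute`), which extends by zero on a complement of N inside T.
The extension is inner, so X comes from `R` after all: a contradiction. -/

/-! ### Characters along a stable flag -/

/-- The eigenvalues along a full flag stabilised by a solvable Lie algebra: linear functionals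
whose values are eigenvalues, and whose simultaneous vanishing detects nilpotency. -/
theorem exists_flag_characters {L : Type*} [LieRing L] [LieAlgebra ℂ L]
    [LieAlgebra.IsSolvable L] (n : ℕ) :
    ∀ (M : Type v) [AddCommGroup M] [Module ℂ M] [LieRingModule L M] [LieModule ℂ L M]
      [FiniteDimensional ℂ M], Module.finrank ℂ M = n →
    ∃ χ : Fin n → Module.Dual ℂ L,
      (∀ i (x y : L), χ i ⁅x, y⁆ = 0) ∧
      (∀ i x, (LieModule.toEnd ℂ L M x).HasEigenvalue (χ i x)) ∧
      (∀ x, (∀ i, χ i x = 0) → IsNilpotent (LieModule.toEnd ℂ L M x)) := by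
  induction n with
  | zero =>
    intro M _ _ _ _ _ hM
    have : Subsingleton M := Module.finrank_zero_iff.mp hM
    exact ⟨Fin.elim0, fun i => i.elim0, fun i => i.elim0, fun x _ => ⟨1, Subsingleton.elim _ _⟩⟩
  | succ n ih =>
    intro M _ _ _ _ _ hM
    have : Nontrivial M := Module.nontrivial_of_finrank_pos (R := ℂ) (by omega)
    obtain ⟨χ₀, hχ₀⟩ := LieModule.exists_nontrivial_weightSpace_of_isSolvable ℂ L M
    obtain ⟨⟨m, hm⟩, hm0⟩ := exists_ne (0 : LieModule.weightSpace M χ₀)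
    have hm0 : m ≠ 0 := fun h => hm0 (Subtype.ext h)
    rw [LieModule.mem_weightSpace] at hm
    let P : LieSubmodule ℂ L M :=
      { (ℂ ∙ m) with
        lie_mem := by
          intro x y hy
          obtain ⟨c, rfl⟩ := Submodule.mem_span_singleton.mp hy
          rw [lie_smul, hm]
          exact Submodule.smul_mem _ _ (Submodule.smul_mem _ _ (Submodule.mem_span_singleton_self m)) }
    have hP : ∀ y, y ∈ P ↔ y ∈ (ℂ ∙ m) := fun y => Iff.rfl
    have hPm : P.toSubmodule = (ℂ ∙ m) := rfl
    have hfr : Module.finrank ℂ (M ⧸ P) = n := by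
      have h1 := Submodule.finrank_quotient_add_finrank P.toSubmodule
      have h2 : Module.finrank ℂ P.toSubmodule = 1 := by
        rw [hPm, finrank_span_singleton hm0]
      have h3 : Module.finrank ℂ (M ⧸ P) = Module.finrank ℂ (M ⧸ P.toSubmodule) := rfl
      omega
    have : FiniteDimensional ℂ (M ⧸ P) := inferInstanceAs (FiniteDimensional ℂ (M ⧸ P.toSubmodule))
    obtain ⟨χ, h1, h2, h3⟩ := ih (M ⧸ P) hfr
    refine ⟨Fin.cons χ₀ χ, ?_, ?_, ?_⟩
    · refine Fin.cases ?_ ?_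
      · intro x y
        have := hm ⁅x, y⁆
        rw [lie_lie, hm, hm, lie_smul, lie_smul, hm, hm, smul_comm, sub_self] at this
        simpa [hm0] using this.symm
      · intro i; simpa using h1 i
    · refine Fin.cases ?_ ?_
      · intro x
        simp only [Fin.cons_zero]
        exact Module.End.hasEigenvalue_of_hasEigenvector
          ⟨Module.End.mem_eigenspace_iff.mpr (by simpa using hm x), hm0⟩
      · intro i x
        simp only [Fin.cons_succ]
        have hq := (h2 i x)
        -- In finite dimension a scalar is an eigenvalue iff the shifted map is not surjective, and
        -- surjectivity descends to the quotient.
        rw [Module.End.hasEigenvalue_iff_mem_spectrum, spectrum.mem_iff,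
          LinearMap.isUnit_iff_range_eq_top, LinearMap.range_eq_top] at hq ⊢
        contrapose! hq
        intro y
        obtain ⟨y, rfl⟩ := LieSubmodule.Quotient.surjective_mk' P y
        obtain ⟨z, rfl⟩ := hq y
        refine ⟨LieSubmodule.Quotient.mk' P z, ?_⟩
        simp [Module.algebraMap_end_apply]
        rfl
    · intro x hx
      obtain ⟨k, hk⟩ := h3 x (fun i => by simpa using hx i.succ)
      have hx0 : χ₀ x = 0 := by simpa using hx 0
      -- The k-th power lands in the line spanned by m, which x kills since `χ₀ x = 0`.
      refine ⟨k + 1, ?_⟩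
      ext y
      have hmk : ∀ (j : ℕ), LieSubmodule.Quotient.mk' P ((LieModule.toEnd ℂ L M x ^ j) y) =
          (LieModule.toEnd ℂ L (M ⧸ P) x ^ j) (LieSubmodule.Quotient.mk' P y) := by
        intro j
        induction j with
        | zero => simp
        | succ j ihj => rw [pow_succ', pow_succ', Module.End.mul_apply, Module.End.mul_apply, ← ihj]; simp
      have h4 : (LieModule.toEnd ℂ L M x ^ k) y ∈ P := by
        have := hmk k
        rw [hk] at this
        simpa using this
      rw [hP, Submodule.mem_span_singleton] at h4
      obtain ⟨c, hc⟩ := h4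
      rw [pow_succ', Module.End.mul_apply, ← hc]
      simp [hm, hx0]

/-! ### The nilradical as the set of ad-nilpotent elements -/

section Nilradical
variable {L : Type u} [LieRing L] [LieAlgebra ℂ L] [FiniteDimensional ℂ L]

theorem isNilpotent_ad_of_mem_of_isNilpotent (I : LieIdeal ℂ L) [LieRing.IsNilpotent I] {x : L}
    (hx : x ∈ I) : IsNilpotent (LieAlgebra.ad ℂ L x) := by
  obtain ⟨k, hk⟩ := (LieAlgebra.isNilpotent_iff_forall (R := ℂ)).mp ‹LieRing.IsNilpotent I› ⟨x, hx⟩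
  -- The extra application of ad x moves y into I.
  refine ⟨k + 1, ?_⟩
  ext y
  have h : ∀ (j : ℕ) (z : I), (LieAlgebra.ad ℂ L x ^ j) (z : L) =
      ((LieAlgebra.ad ℂ I ⟨x, hx⟩ ^ j) z : I) := by
    intro j z
    induction j with
    | zero => simp
    | succ j ihj => rw [pow_succ', pow_succ', Module.End.mul_apply, Module.End.mul_apply, ihj]; simp
  have hy : ⁅x, y⁆ ∈ I := lie_mem_left ℂ L I x y hx
  rw [pow_succ, Module.End.mul_apply, LieAlgebra.ad_apply, h k ⟨_, hy⟩, hk]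
  simp

/-- Engel's theorem, with ad-nilpotency restricted from `L` to `I`. -/
theorem isNilpotent_of_forall_isNilpotent_ad (I : LieIdeal ℂ L)
    (h : ∀ y ∈ I, IsNilpotent (LieAlgebra.ad ℂ L y)) : LieRing.IsNilpotent I := by
  refine (LieAlgebra.isNilpotent_iff_forall (R := ℂ)).mpr fun y => ?_
  exact LieSubalgebra.isNilpotent_ad_of_isNilpotent_ad (I.toLieSubalgebra) (h y y.2)

variable [LieAlgebra.IsSolvable L]

variable (L) in
/-- The elements of a solvable Lie algebra with nilpotent adjoint action form an ideal. -/
theorem exists_lieIdeal_forall_isNilpotent_ad :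
    ∃ I : LieIdeal ℂ L, (∀ x, x ∈ I ↔ IsNilpotent (LieAlgebra.ad ℂ L x)) ∧
      ∀ x y : L, ⁅x, y⁆ ∈ I := by
  obtain ⟨χ, h1, h2, h3⟩ := exists_flag_characters (L := L) _ L rfl
  refine ⟨{ (⨅ i, LinearMap.ker (χ i)) with lie_mem := ?_ }, ?_, ?_⟩
  · intro x y hy
    simp [h1]
  · intro x
    change x ∈ (⨅ i, LinearMap.ker (χ i)) ↔ _
    simp only [Submodule.mem_iInf, LinearMap.mem_ker]
    exact ⟨h3 x, fun h i => ((h2 i x).isNilpotent_of_isNilpotent h).eq_zero⟩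
  · intro x y
    change _ ∈ (⨅ i, LinearMap.ker (χ i))
    simp [h1]

theorem mem_lieNilradical_iff {x : L} :
    x ∈ lieNilradical L ↔ IsNilpotent (LieAlgebra.ad ℂ L x) := by
  obtain ⟨I, hI, -⟩ := exists_lieIdeal_forall_isNilpotent_ad L
  rw [← hI]
  suffices lieNilradical L = I by rw [this]
  apply le_antisymm
  · refine sSup_le fun J hJ y hy => (hI y).mpr ?_
    have : LieRing.IsNilpotent J := hJ
    exact isNilpotent_ad_of_mem_of_isNilpotent J hy
  · refine le_sSup ?_
    exact isNilpotent_of_forall_isNilpotent_ad I fun y hy => (hI y).mp hy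

theorem lie_mem_lieNilradical (x y : L) : ⁅x, y⁆ ∈ lieNilradical L := by
  obtain ⟨I, hI, h⟩ := exists_lieIdeal_forall_isNilpotent_ad L
  exact mem_lieNilradical_iff.mpr ((hI _).mp (h x y))

instance isNilpotent_lieNilradical : LieRing.IsNilpotent (lieNilradical L) :=
  isNilpotent_of_forall_isNilpotent_ad _ fun _ hy => mem_lieNilradical_iff.mp hy

end Nilradical

/-! ### Derivations and the abelianization -/

section Abelianization
variable (N : Type u) [LieRing N] [LieAlgebra ℂ N]

/-- The abelianization `N / [N, N]`, as a vector space. -/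
abbrev LieAb : Type u := N ⧸ (⁅(⊤ : LieIdeal ℂ N), (⊤ : LieIdeal ℂ N)⁆).toSubmodule

variable {N}

theorem lie_mem_lowerCentralSeries_succ {k : ℕ} (a : N) {c : N}
    (hc : c ∈ LieModule.lowerCentralSeries ℂ N N k) :
    ⁅a, c⁆ ∈ LieModule.lowerCentralSeries ℂ N N (k + 1) := by
  rw [LieModule.lowerCentralSeries_succ]
  exact LieSubmodule.lie_mem_lie (LieSubmodule.mem_top _) hc

theorem lowerCentralSeries_succ_induction {k : ℕ} (P : Submodule ℂ N)
    (h : ∀ (a c : N), c ∈ LieModule.lowerCentralSeries ℂ N N k → ⁅a, c⁆ ∈ P) {x : N}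
    (hx : x ∈ LieModule.lowerCentralSeries ℂ N N (k + 1)) : x ∈ P := by
  rw [LieModule.lowerCentralSeries_succ, ← LieSubmodule.mem_toSubmodule,
    LieSubmodule.lieIdeal_oper_eq_linear_span'] at hx
  refine Submodule.span_le.mpr ?_ hx
  rintro _ ⟨a, -, c, hc, rfl⟩
  exact h a c hc

/-- By Jacobi, bracketing with ⁅x, y⁆ amounts to two successive brackets, each going one step down
the series. -/
theorem lie_one_mem_lowerCentralSeries {k : ℕ} {b c : N}
    (hb : b ∈ LieModule.lowerCentralSeries ℂ N N 1)
    (hc : c ∈ LieModule.lowerCentralSeries ℂ N N k) :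
    ⁅b, c⁆ ∈ LieModule.lowerCentralSeries ℂ N N (k + 2) := by
  let P : Submodule ℂ N := (LieModule.lowerCentralSeries ℂ N N (k + 2)).toSubmodule.comap
    (-(LieAlgebra.ad ℂ N c : N →ₗ[ℂ] N))
  have : b ∈ P := by
    refine lowerCentralSeries_succ_induction P (k := 0) (fun x y _ => ?_) hb
    simp only [P, Submodule.mem_comap, LinearMap.neg_apply, LieAlgebra.ad_apply, lie_skew,
      LieSubmodule.mem_toSubmodule]
    rw [lie_lie]
    exact sub_mem
      (lie_mem_lowerCentralSeries_succ _ (lie_mem_lowerCentralSeries_succ _ hc))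
      (lie_mem_lowerCentralSeries_succ _ (lie_mem_lowerCentralSeries_succ _ hc))
  rw [← lie_skew, neg_mem_iff]
  simpa only [P, Submodule.mem_comap, LinearMap.neg_apply, LieAlgebra.ad_apply,
    LieSubmodule.mem_toSubmodule, neg_mem_iff] using this

namespace LieDerivation

theorem apply_mem_lowerCentralSeries (D : LieDerivation ℂ N N) (k : ℕ) :
    ∀ x ∈ LieModule.lowerCentralSeries ℂ N N k,
      D x ∈ LieModule.lowerCentralSeries ℂ N N k := by
  induction k with
  | zero => simp
  | succ k ih =>
    intro x hx
    refine lowerCentralSeries_succ_induction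
      ((LieModule.lowerCentralSeries ℂ N N (k + 1)).toSubmodule.comap (D : N →ₗ[ℂ] N))
      (fun a c hc => ?_) hx
    simp only [Submodule.mem_comap, LieDerivation.coeFn_coe, LieDerivation.apply_lie_eq_add,
      LieSubmodule.mem_toSubmodule]
    refine add_mem (lie_mem_lowerCentralSeries_succ _ (ih c hc))
      (lie_mem_lowerCentralSeries_succ _ hc)

theorem iterate_mem_lowerCentralSeries (D : LieDerivation ℂ N N) (k j : ℕ) {x : N}
    (hx : x ∈ LieModule.lowerCentralSeries ℂ N N k) :
    D^[j] x ∈ LieModule.lowerCentralSeries ℂ N N k := by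
  induction j with
  | zero => simpa
  | succ j ih =>
    rw [Function.iterate_succ_apply']
    exact apply_mem_lowerCentralSeries D k _ ih

/-- The endomorphism of `N / [N, N]` induced by a derivation of `N`. -/
def onAb : LieDerivation ℂ N N →ₗ[ℂ] Module.End ℂ (LieAb N) where
  toFun D := Submodule.mapQ _ _ (D : N →ₗ[ℂ] N) fun x hx => apply_mem_lowerCentralSeries D 1 x hx
  map_add' D E := by ext; rfl
  map_smul' c D := by ext; rfl

@[simp] theorem onAb_mk (D : LieDerivation ℂ N N) (x : N) :
    onAb D (Submodule.Quotient.mk x : LieAb N) = Submodule.Quotient.mk (D x) := rfl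

theorem onAb_lie (D E : LieDerivation ℂ N N) :
    onAb ⁅D, E⁆ = onAb D * onAb E - onAb E * onAb D := by
  ext x
  simp

theorem onAb_pow_mk (D : LieDerivation ℂ N N) (k : ℕ) (x : N) :
    (onAb D ^ k) (Submodule.Quotient.mk x : LieAb N) = Submodule.Quotient.mk (D^[k] x) := by
  induction k with
  | zero => simp
  | succ k ih => rw [pow_succ', Module.End.mul_apply, ih, onAb_mk, Function.iterate_succ_apply']

/-- A derivation of a nilpotent Lie algebra is nilpotent as soon as it is so modulo `[N, N]`. -/
theorem exists_iterate_eq_zero_of_isNilpotent_onAb [LieRing.IsNilpotent N]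
    (D : LieDerivation ℂ N N) (hD : IsNilpotent (onAb D)) : ∃ m : ℕ, ∀ x, D^[m] x = 0 := by
  obtain ⟨m₀, hm₀⟩ := hD
  have h0 : ∀ j, m₀ ≤ j → ∀ x, D^[j] x ∈ LieModule.lowerCentralSeries ℂ N N 1 := by
    intro j hj x
    obtain ⟨i, rfl⟩ := Nat.exists_eq_add_of_le' hj
    rw [Function.iterate_add_apply]
    refine iterate_mem_lowerCentralSeries D 1 i ?_
    have := onAb_pow_mk D m₀ x
    rw [hm₀, LinearMap.zero_apply, eq_comm, Submodule.Quotient.mk_eq_zero] at this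
    exact this
  have step : ∀ k, ∃ m : ℕ, ∀ x ∈ LieModule.lowerCentralSeries ℂ N N k,
      D^[m] x ∈ LieModule.lowerCentralSeries ℂ N N (k + 1) := by
    intro k
    induction k with
    | zero => exact ⟨m₀, fun x _ => h0 m₀ le_rfl x⟩
    | succ k ih =>
      obtain ⟨m, hm⟩ := ih
      -- In the Leibniz expansion on ⁅a, c⁆, each term either has at least `m₀` derivatives on a,
      -- pushing it into N², or at least `m` on c, pushing it one step deeper.
      refine ⟨m₀ + m, fun x hx => ?_⟩
      have := lowerCentralSeries_succ_induction
        ((LieModule.lowerCentralSeries ℂ N N (k + 2)).toSubmodule.comap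
          ((D : N →ₗ[ℂ] N) ^ (m₀ + m))) (fun a c hc => ?_) hx
      · simpa [Module.End.pow_apply] using this
      simp only [Submodule.mem_comap, Module.End.pow_apply, LieDerivation.coeFn_coe,
        LieDerivation.iterate_apply_lie, LieSubmodule.mem_toSubmodule]
      refine sum_mem fun ij hij => nsmul_mem ?_ _
      replace hij := Finset.HasAntidiagonal.mem_antidiagonal.mp hij
      rcases le_or_gt m₀ ij.1 with h | h
      · exact lie_one_mem_lowerCentralSeries (h0 _ h a) (iterate_mem_lowerCentralSeries D k _ hc)
      · refine lie_mem_lowerCentralSeries_succ _ ?_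
        obtain ⟨i, hi⟩ := Nat.exists_eq_add_of_le' (show m ≤ ij.2 by omega)
        rw [hi, Function.iterate_add_apply]
        exact iterate_mem_lowerCentralSeries D _ _ (hm c hc)
  have all : ∀ k, ∃ m : ℕ, ∀ x, D^[m] x ∈ LieModule.lowerCentralSeries ℂ N N k := by
    intro k
    induction k with
    | zero => exact ⟨0, by simp⟩
    | succ k ih =>
      obtain ⟨m, hm⟩ := ih
      obtain ⟨m', hm'⟩ := step k
      exact ⟨m' + m, fun x => by rw [Function.iterate_add_apply]; exact hm' _ (hm x)⟩
  obtain ⟨k, hk⟩ := LieModule.IsNilpotent.nilpotent ℂ N N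
  obtain ⟨m, hm⟩ := all k
  exact ⟨m, fun x => by simpa [hk] using hm x⟩

end LieDerivation
end Abelianization

/-! ### Action of a Lie algebra on the abelianization of an ideal -/

section Action
variable {L : Type u} [LieRing L] [LieAlgebra ℂ L] {N : Type v} [LieRing N] [LieAlgebra ℂ N]

/-- The action by derivations of a Lie algebra on an ideal, transported along an isomorphism. -/
def derivationOfIdeal (I : LieIdeal ℂ L) (φ : N ≃ₗ⁅ℂ⁆ I) : L →ₗ[ℂ] LieDerivation ℂ N N where
  toFun x :=
    { toFun := fun n => φ.symm ⁅x, φ n⁆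
      map_add' := by simp
      map_smul' := by simp
      leibniz' := fun a b => by
        apply φ.injective
        have h : ∀ c d : N, φ ⁅c, d⁆ = ⁅φ c, φ d⁆ := φ.toLieHom.map_lie
        change φ (φ.symm ⁅x, φ ⁅a, b⁆⁆) =
          φ (⁅a, φ.symm ⁅x, φ b⁆⁆ - ⁅b, φ.symm ⁅x, φ a⁆⁆)
        rw [map_sub, h, h, LieEquiv.apply_symm_apply, LieEquiv.apply_symm_apply,
          h, LieEquiv.apply_symm_apply]
        apply Subtype.ext
        simp only [LieSubmodule.coe_bracket, LieIdeal.coe_bracket_of_module, LieSubmodule.coe_sub]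
        rw [leibniz_lie x, ← lie_skew (φ b : L) ⁅x, _⁆]
        simp [add_comm] }
  map_add' x y := by ext; simp
  map_smul' c x := by ext; simp

theorem coe_derivationOfIdeal (I : LieIdeal ℂ L) (φ : N ≃ₗ⁅ℂ⁆ I) (x : L) (n : N) :
    (φ (derivationOfIdeal I φ x n) : L) = ⁅x, (φ n : L)⁆ := by
  simp [derivationOfIdeal]

theorem coe_derivationOfIdeal_iterate (I : LieIdeal ℂ L) (φ : N ≃ₗ⁅ℂ⁆ I) (x : L) (n : N) (k : ℕ) :
    (φ ((derivationOfIdeal I φ x)^[k] n) : L) = (LieAlgebra.ad ℂ L x ^ k) (φ n : L) := by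
  induction k with
  | zero => simp
  | succ k ih =>
    rw [Function.iterate_succ_apply', coe_derivationOfIdeal, ih, pow_succ', Module.End.mul_apply,
      LieAlgebra.ad_apply]

/-- The action of a Lie algebra on the abelianization of (an isomorphic copy of) an ideal. -/
def actionOnAb (I : LieIdeal ℂ L) (φ : N ≃ₗ⁅ℂ⁆ I) : L →ₗ[ℂ] Module.End ℂ (LieAb N) :=
  LieDerivation.onAb ∘ₗ derivationOfIdeal I φ

theorem actionOnAb_eq_zero_of_mem (I : LieIdeal ℂ L) (φ : N ≃ₗ⁅ℂ⁆ I) {x : L} (hx : x ∈ I) :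
    actionOnAb I φ x = 0 := by
  ext n
  simp only [actionOnAb, LinearMap.comp_apply, Submodule.mkQ_apply, LieDerivation.onAb_mk,
    LinearMap.zero_apply]
  rw [Submodule.Quotient.mk_eq_zero]
  have : derivationOfIdeal I φ x n = ⁅φ.symm ⟨x, hx⟩, n⁆ :=
    φ.injective <| Subtype.ext <| by
      have h : ∀ c d : N, φ ⁅c, d⁆ = ⁅φ c, φ d⁆ := φ.toLieHom.map_lie
      refine (coe_derivationOfIdeal I φ x n).trans ?_
      change _ = ((φ ⁅φ.symm ⟨x, hx⟩, n⁆ : I) : L)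
      rw [h]
      simp
  rw [this]
  exact LieSubmodule.lie_mem_lie (LieSubmodule.mem_top _) (LieSubmodule.mem_top _)

theorem actionOnAb_lie (I : LieIdeal ℂ L) (φ : N ≃ₗ⁅ℂ⁆ I) (x y : L) :
    actionOnAb I φ ⁅x, y⁆ = actionOnAb I φ x * actionOnAb I φ y -
      actionOnAb I φ y * actionOnAb I φ x := by
  simp only [actionOnAb, LinearMap.comp_apply, ← LieDerivation.onAb_lie]
  congr 1
  ext n
  refine φ.injective <| Subtype.ext ?_
  simp [coe_derivationOfIdeal]

variable [FiniteDimensional ℂ L] [LieAlgebra.IsSolvable L] (φ : N ≃ₗ⁅ℂ⁆ lieNilradical L)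

theorem commute_actionOnAb (x y : L) :
    Commute (actionOnAb _ φ x) (actionOnAb _ φ y) := by
  have := actionOnAb_lie _ φ x y
  rw [actionOnAb_eq_zero_of_mem _ φ (lie_mem_lieNilradical x y)] at this
  exact (sub_eq_zero.mp this.symm)

/-- Nilpotency on N/N² lifts to N, and ad x maps all of `L` into the nilradical. -/
theorem mem_lieNilradical_of_isNilpotent_actionOnAb {x : L}
    (hx : IsNilpotent (actionOnAb _ φ x)) : x ∈ lieNilradical L := by
  have : LieRing.IsNilpotent N := φ.nilpotent_iff_equiv_nilpotent.mpr inferInstance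
  obtain ⟨m, hm⟩ := LieDerivation.exists_iterate_eq_zero_of_isNilpotent_onAb _ hx
  refine mem_lieNilradical_iff.mpr ⟨m + 1, ?_⟩
  ext y
  have := coe_derivationOfIdeal_iterate _ φ x (φ.symm ⟨⁅x, y⁆, lie_mem_lieNilradical x y⟩) m
  rw [hm] at this
  rw [pow_succ, Module.End.mul_apply, LieAlgebra.ad_apply]
  simpa using this.symm

theorem ker_actionOnAb :
    LinearMap.ker (actionOnAb _ φ) = (lieNilradical L).toSubmodule := by
  ext x
  exact ⟨fun h => mem_lieNilradical_of_isNilpotent_actionOnAb φ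
      (by rw [LinearMap.mem_ker.mp h]; exact IsNilpotent.zero),
    fun h => actionOnAb_eq_zero_of_mem _ φ h⟩

theorem finrank_range_actionOnAb {Q : Submodule ℂ L}
    (hQ : IsCompl (lieNilradical L).toSubmodule Q) :
    Module.finrank ℂ (LinearMap.range (actionOnAb _ φ)) = Module.finrank ℂ Q := by
  have h1 := LinearMap.finrank_range_add_finrank_ker (actionOnAb _ φ)
  have h2 := Submodule.finrank_add_eq_of_isCompl hQ
  rw [ker_actionOnAb] at h1
  omega

end Action

/-! ### Commutator-closed spaces containing the diagonal -/

section MatrixUnits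

/-- A subspace of an algebra closed under commutators and containing a complete family of
orthogonal idempotents of rank one is closed under multiplication. -/
theorem mul_mem_of_commutator_mem {A ι : Type*} [Ring A] [Algebra ℂ A] [Fintype ι] [DecidableEq ι]
    (p : ι → A) (hp : ∀ i, p i * p i = p i) (hpq : ∀ i j, i ≠ j → p i * p j = 0)
    (hsum : ∑ i, p i = 1) (hrank : ∀ i X, ∃ c : ℂ, p i * X * p i = c • p i)
    (G : Submodule ℂ A) (hpG : ∀ i, p i ∈ G)
    (hG : ∀ X ∈ G, ∀ Y ∈ G, X * Y - Y * X ∈ G) {X Y : A} (hX : X ∈ G) (hY : Y ∈ G) :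
    X * Y ∈ G := by
  have key : ∀ Z ∈ G, ∀ i j, p i * Z * p j ∈ G := by
    intro Z hZ i j
    rcases eq_or_ne i j with rfl | hij
    · obtain ⟨c, hc⟩ := hrank i Z
      rw [hc]
      exact G.smul_mem _ (hpG i)
    -- The double commutator isolates the (i, j) and (j, i) blocks; one more with `p i` flips the
    -- sign of the second, and averaging leaves the first.
    · have h1 := hG _ (hG _ (hpG i) _ hZ) _ (hpG j)
      have e1 : (p i * Z - Z * p i) * p j - p j * (p i * Z - Z * p i) =
          p i * Z * p j + p j * Z * p i := by
        have a := hpq i j hij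
        have b := hpq j i hij.symm
        calc _ = p i * Z * p j - Z * (p i * p j) - (p j * p i) * Z + p j * Z * p i := by
              noncomm_ring
          _ = _ := by rw [a, b]; noncomm_ring
      rw [e1] at h1
      have h2 := hG _ (hpG i) _ h1
      have e2 : p i * (p i * Z * p j + p j * Z * p i) - (p i * Z * p j + p j * Z * p i) * p i =
          p i * Z * p j - p j * Z * p i := by
        have a := hpq i j hij
        have b := hpq j i hij.symm
        calc _ = (p i * p i) * Z * p j + (p i * p j) * Z * p i - p i * Z * (p j * p i)
              - p j * Z * (p i * p i) := by noncomm_ring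
          _ = _ := by rw [a, b, hp]; noncomm_ring
      rw [e2] at h2
      have h3 := G.smul_mem (2⁻¹ : ℂ) (G.add_mem h1 h2)
      have e3 : (2⁻¹ : ℂ) • (p i * Z * p j + p j * Z * p i + (p i * Z * p j - p j * Z * p i)) =
          p i * Z * p j := by
        rw [add_add_sub_cancel, ← two_smul ℂ (p i * Z * p j), smul_smul]
        norm_num
      rwa [e3] at h3
  have expand : X * Y = ∑ i, ∑ l, ∑ j, (p i * X * p j) * (p j * Y * p l) := by
    have inner : ∀ i l, ∑ j, (p i * X * p j) * (p j * Y * p l) = p i * (X * Y) * p l := by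
      intro i l
      calc _ = ∑ j, (p i * X) * p j * (Y * p l) := Finset.sum_congr rfl fun j _ => by
            conv_rhs => rw [← hp j]
            simp only [mul_assoc]
        _ = _ := by
            rw [← Finset.sum_mul, ← Finset.mul_sum, hsum]; simp only [mul_assoc, one_mul]
    simp_rw [inner, ← Finset.mul_sum, hsum, mul_one, ← Finset.sum_mul, hsum, one_mul]
  rw [expand]
  refine sum_mem fun i _ => sum_mem fun l _ => sum_mem fun j _ => ?_
  rcases eq_or_ne i l with rfl | hil
  · obtain ⟨c, hc⟩ := hrank i (X * p j * p j * Y)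
    have : p i * X * p j * (p j * Y * p i) = c • p i := by rw [← hc]; noncomm_ring
    rw [this]
    exact G.smul_mem _ (hpG i)
  -- For i ≠ l the product in reverse order vanishes, so this product is itself a commutator.
  · have h := hG _ (key X hX i j) _ (key Y hY j l)
    have e : p j * Y * p l * (p i * X * p j) = 0 := by
      calc _ = p j * Y * (p l * p i) * X * p j := by noncomm_ring
        _ = 0 := by rw [hpq l i hil.symm]; simp
    rwa [e, sub_zero] at h

variable {V : Type*} [AddCommGroup V] [Module ℂ V] {ι : Type*}

/-- The projection onto a line spanned by a basis vector. -/
noncomputable def Module.Basis.lineProj (b : Module.Basis ι ℂ V) (i : ι) : Module.End ℂ V :=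
  (b.coord i).smulRight (b i)

namespace Module.Basis
variable (b : Module.Basis ι ℂ V)

theorem lineProj_apply (i : ι) (v : V) : b.lineProj i v = b.coord i v • b i := rfl

theorem lineProj_mul_mul (i j : ι) (X : Module.End ℂ V) (v : V) :
    (b.lineProj i * X * b.lineProj j) v = (b.coord j v * b.coord i (X (b j))) • b i := by
  simp [lineProj_apply, smul_smul]

theorem sum_lineProj [Fintype ι] : ∑ i, b.lineProj i = 1 := by
  ext v
  simp [lineProj_apply, b.sum_repr]

/-- An endomorphism commuting with one that is diagonal with distinct eigenvalues is diagonal. -/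
theorem mem_span_lineProj_of_commute [Fintype ι] [DecidableEq ι] {f g : Module.End ℂ V} {μ : ι → ℂ}
    (hμ : Function.Injective μ) (hf : ∀ i, f (b i) = μ i • b i) (h : Commute f g) :
    g ∈ Submodule.span ℂ (Set.range b.lineProj) := by
  have hcoord : ∀ i v, b.coord i (f v) = μ i * b.coord i v := by
    intro i v
    have : b.coord i ∘ₗ f = μ i • b.coord i := by
      refine b.ext fun j => ?_
      rcases eq_or_ne i j with rfl | hij
      · simp [hf]
      · simp [hf, hij]
    simpa using LinearMap.congr_fun this v
  have hg : ∀ i, g (b i) = b.coord i (g (b i)) • b i := by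
    intro i
    refine b.ext_elem fun j => ?_
    rcases eq_or_ne j i with rfl | hij
    · simp
    · have h1 := hcoord j (g (b i))
      have h2 : f (g (b i)) = μ i • g (b i) := by
        rw [← Module.End.mul_apply, h.eq, Module.End.mul_apply, hf, map_smul]
      rw [h2, map_smul, smul_eq_mul] at h1
      have h3 : (μ i - μ j) * b.coord j (g (b i)) = 0 := by rw [sub_mul, h1, sub_self]
      have h4 : b.coord j (g (b i)) = 0 :=
        (mul_eq_zero.mp h3).resolve_left (sub_ne_zero.mpr fun e => hij (hμ e).symm)
      simpa [hij] using h4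
  have : g = ∑ i, b.coord i (g (b i)) • b.lineProj i := by
    refine b.ext fun j => ?_
    rw [hg j]
    simp [LinearMap.sum_apply, lineProj_apply, Finsupp.single_apply, ite_smul]
  rw [this]
  exact sum_mem fun i _ => Submodule.smul_mem _ _ (Submodule.subset_span ⟨i, rfl⟩)

end Module.Basis
end MatrixUnits

/-! ### Centralizers of semisimple elements -/

section Centralizer
open Polynomial
variable {V : Type*} [AddCommGroup V] [Module ℂ V] [FiniteDimensional ℂ V]

theorem aeval_eq_of_forall_eigenvalue {t : Module.End ℂ V} (ht : t.IsSemisimple) {q q' : ℂ[X]}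
    (h : ∀ μ, t.HasEigenvalue μ → q.eval μ = q'.eval μ) : aeval t q = aeval t q' := by
  rw [← sub_eq_zero, ← map_sub]
  rcases eq_or_ne (q - q') 0 with h0 | h0
  · rw [h0, map_zero]
  refine (minpoly.dvd_iff).mp ?_
  have hm : minpoly ℂ t ≠ 0 := minpoly.ne_zero (Algebra.IsIntegral.isIntegral t)
  rw [IsAlgClosed.dvd_iff_roots_le_roots hm h0]
  rw [Multiset.le_iff_subset (nodup_roots (PerfectField.separable_iff_squarefree.mpr
    ht.minpoly_squarefree))]
  intro μ hμ
  rw [mem_roots h0, IsRoot.def, eval_sub, sub_eq_zero]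
  exact h μ (Module.End.hasEigenvalue_iff_isRoot.mpr (isRoot_of_mem_roots hμ))

/-- In an algebra of endomorphisms containing all diagonal ones, the centralizer of a semisimple
`t` is not contained in a subspace of `ℂ[t]` of dimension less than `dim V`. -/
theorem exists_commute_notMem {ι : Type*} [Fintype ι] (b : Module.Basis ι ℂ V)
    (A : Subalgebra ℂ (Module.End ℂ V)) (hA : ∀ i, b.lineProj i ∈ A) {t : Module.End ℂ V}
    (htA : t ∈ A) (ht : t.IsSemisimple) (U : Submodule ℂ (Module.End ℂ V))
    (hU : ∀ X ∈ U, ∃ q : ℂ[X], aeval t q = X)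
    (hdim : Module.finrank ℂ U < Module.finrank ℂ V) :
    ∃ X ∈ A, Commute X t ∧ X ∉ U := by
  -- If the centralizer lay in U, its elements would be polynomials in t. This forces each
  -- eigenspace to be a line, so t has dim V eigenvalues, with independent spectral projections in
  -- U.
  by_contra! h
  have haA : ∀ q : ℂ[X], aeval t q ∈ A := fun q => by
    have := (aeval (⟨t, htA⟩ : A) q).2
    rwa [← Subalgebra.coe_val, ← Polynomial.aeval_algHom_apply] at this
  have haU : ∀ q : ℂ[X], aeval t q ∈ U := fun q =>
    h _ (haA q) (by
      have := Commute.all q X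
      simpa using this.map (aeval t))
  classical
  let s : Finset ℂ := (minpoly ℂ t).roots.toFinset
  have hs : ∀ μ, μ ∈ s ↔ t.HasEigenvalue μ := fun μ => by
    rw [Module.End.hasEigenvalue_iff_isRoot, Multiset.mem_toFinset,
      mem_roots (minpoly.ne_zero (Algebra.IsIntegral.isIntegral t))]
  let P : ℂ → Module.End ℂ V := fun μ => aeval t (Lagrange.basis s id μ)
  have hinj : Set.InjOn (id : ℂ → ℂ) s := Function.injective_id.injOn
  have hself : ∀ μ ∈ s, (Lagrange.basis s id μ).eval μ = 1 := fun μ hμ =>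
    Lagrange.eval_basis_self hinj hμ
  have hne : ∀ μ ν, μ ≠ ν → ν ∈ s → (Lagrange.basis s id μ).eval ν = 0 := fun μ ν hμν hν =>
    Lagrange.eval_basis_of_ne (v := id) hμν hν
  have hqP : ∀ (q : ℂ[X]), ∀ μ ∈ s, aeval t q * P μ = q.eval μ • P μ := by
    intro q μ hμ
    have : aeval t (q * Lagrange.basis s id μ) = aeval t (C (q.eval μ) * Lagrange.basis s id μ) := by
      refine aeval_eq_of_forall_eigenvalue ht fun ν hν => ?_
      rw [eval_mul, eval_mul, eval_C]
      rcases eq_or_ne μ ν with rfl | hμν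
      · rfl
      · rw [hne μ ν hμν ((hs ν).mpr hν)]; simp
    simpa [P, Algebra.smul_def] using this
  have hPP : ∀ μ ∈ s, P μ * P μ = P μ := fun μ hμ => by
    rw [hqP _ μ hμ, hself μ hμ, one_smul]
  have hsumP : ∑ μ ∈ s, P μ = 1 := by
    have : aeval t (∑ μ ∈ s, Lagrange.basis s id μ) = aeval t (1 : ℂ[X]) := by
      refine aeval_eq_of_forall_eigenvalue ht fun ν hν => ?_
      rw [eval_finsetSum, Finset.sum_eq_single ν, hself ν ((hs ν).mpr hν), eval_one]
      · exact fun μ _ hμ => hne μ ν hμ ((hs ν).mpr hν)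
      · exact fun hh => absurd ((hs ν).mpr hν) hh
    simpa using this
  have hcard : s.card ≤ Module.finrank ℂ U := by
    have hv : ∀ μ : s, ∃ v, t.HasEigenvector (μ : ℂ) v := fun μ =>
      ((hs μ).mp μ.2).exists_hasEigenvector
    choose v hv using hv
    have hli : LinearIndependent ℂ (fun μ : s => (⟨P μ, haU _⟩ : U)) := by
      rw [Fintype.linearIndependent_iff]
      intro c hc ν
      have h1 : ∑ μ : s, c μ • P μ = 0 := by
        have := congrArg (U.subtype) hc
        simpa using this
      have h2 := LinearMap.congr_fun h1 (v ν)
      rw [LinearMap.sum_apply, Finset.sum_eq_single ν] at h2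
      · rw [LinearMap.smul_apply, Module.End.aeval_apply_of_hasEigenvector (hv ν), hself _ ν.2,
          one_smul, LinearMap.zero_apply] at h2
        exact (smul_eq_zero.mp h2).resolve_right (hv ν).2
      · intro μ _ hμ
        rw [LinearMap.smul_apply, Module.End.aeval_apply_of_hasEigenvector (hv ν),
          hne _ _ (fun e => hμ (Subtype.ext e)) ν.2, zero_smul, smul_zero]
      · simp
    simpa using hli.fintype_card_le_finrank
  have hline : ∀ μ ∈ s, ∃ w, ∀ y, P μ y ∈ (ℂ ∙ w) := by
    intro μ hμ
    have hc : ∀ j, ∃ c : ℂ, P μ * b.lineProj j * P μ = c • P μ := by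
      intro j
      -- The compression commutes with t, so it is a polynomial in t, which acts as a scalar on the
      -- eigenspace.
      have hmem : P μ * b.lineProj j * P μ ∈ U := by
        refine h _ (A.mul_mem (A.mul_mem (haA _) (hA j)) (haA _)) ?_
        have h1 : t * P μ = μ • P μ := by simpa using hqP X μ hμ
        have h2 : P μ * t = μ • P μ := by
          rw [← h1]
          have := (Commute.all (Lagrange.basis s id μ) X).map (aeval t)
          rw [aeval_X] at this
          exact this.eq
        rw [Commute, SemiconjBy, mul_assoc _ _ t, h2, ← mul_assoc t, ← mul_assoc t, h1]
        simp
      obtain ⟨q, hq⟩ := hU _ hmem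
      refine ⟨q.eval μ, ?_⟩
      rw [← hqP q μ hμ, hq, mul_assoc (P μ * b.lineProj j), hPP μ hμ]
    choose c hc using hc
    -- The compressions add up to `P μ`. Either all vanish and `P μ = 0`, or `P μ` is a multiple of
    -- one that factors through a line.
    by_cases hall : ∀ j, c j = 0
    · refine ⟨0, fun y => ?_⟩
      have : P μ = 0 := by
        calc P μ = P μ * (∑ j, b.lineProj j) * P μ := by rw [b.sum_lineProj, mul_one, hPP μ hμ]
          _ = ∑ j, P μ * b.lineProj j * P μ := by rw [Finset.mul_sum, Finset.sum_mul]
          _ = 0 := by simp [hc, hall]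
      simp [this]
    · push Not at hall
      obtain ⟨j, hj⟩ := hall
      refine ⟨P μ (b j), fun y => Submodule.mem_span_singleton.mpr
        ⟨(c j)⁻¹ * b.coord j (P μ y), ?_⟩⟩
      have := LinearMap.congr_fun (hc j) y
      rw [Module.End.mul_apply, Module.End.mul_apply, b.lineProj_apply, map_smul,
        LinearMap.smul_apply] at this
      rw [mul_smul, this, smul_smul, inv_mul_cancel₀ hj, one_smul]
  choose! w hw using hline
  have htop : (⊤ : Submodule ℂ V) ≤ Submodule.span ℂ (s.image w : Finset V) := by
    intro y _
    have : y = ∑ μ ∈ s, P μ y := by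
      rw [← LinearMap.sum_apply, hsumP]; rfl
    rw [this]
    refine sum_mem fun μ hμ => ?_
    refine Submodule.span_mono ?_ (hw μ hμ y)
    simpa using ⟨μ, hμ, rfl⟩
  have h1 := finrank_span_finset_le_card (R := ℂ) (s.image w)
  rw [Set.finrank, top_le_iff.mp htop, finrank_top] at h1
  have h2 := Finset.card_image_le (s := s) (f := w)
  omega

end Centralizer

/-! ### Maximal rank yields all diagonal matrices -/

section MaximalRank

/-- If a solvable Lie algebra has nilradical `N` of codimension `dim N / [N, N]`, then it acts on
`N / [N, N]` by all the diagonal matrices in a suitable basis. -/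
theorem exists_basis_lineProj_mem_range {L : Type v} [LieRing L] [LieAlgebra ℂ L] {N : Type u}
    [LieRing N] [LieAlgebra ℂ N] [FiniteDimensional ℂ L] [LieAlgebra.IsSolvable L]
    [FiniteDimensional ℂ (LieAb N)] (φ : N ≃ₗ⁅ℂ⁆ lieNilradical L) {Q : Submodule ℂ L}
    (hQ : IsCompl (lieNilradical L).toSubmodule Q)
    (hdim : Module.finrank ℂ Q = Module.finrank ℂ (LieAb N)) :
    ∃ b : Module.Basis (Fin (Module.finrank ℂ (LieAb N))) ℂ (LieAb N),
      ∀ i, b.lineProj i ∈ LinearMap.range (actionOnAb _ φ) := by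
  set r := Module.finrank ℂ (LieAb N) with hr
  let : LieRingModule L (LieAb N) :=
    { bracket := fun x v => actionOnAb _ φ x v
      add_lie := fun x y v => by simp
      lie_add := fun x v w => by simp
      leibniz_lie := fun x y v => by simp [actionOnAb_lie] }
  let : LieModule ℂ L (LieAb N) :=
    { smul_lie := fun c x v => by
        change actionOnAb _ φ (c • x) v = c • actionOnAb _ φ x v
        simp
      lie_smul := fun c x v => by
        change actionOnAb _ φ x (c • v) = c • actionOnAb _ φ x v
        simp }
  have htoEnd : ∀ x, LieModule.toEnd ℂ L (LieAb N) x = actionOnAb _ φ x := fun x => rfl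
  obtain ⟨χ, -, h2, h3⟩ := exists_flag_characters (L := L) r (LieAb N) rfl
  have hker : LinearMap.ker (LinearMap.pi χ) ≤ (lieNilradical L).toSubmodule := by
    intro x hx
    refine mem_lieNilradical_of_isNilpotent_actionOnAb φ (h3 x fun i => ?_)
    exact congrFun (LinearMap.mem_ker.mp hx) i
  -- The common kernel lies in the nilradical, of codimension r, so the r characters are independent
  -- and can be prescribed: the values 0, …, r − 1 give distinct eigenvalues.
  have hsurj : LinearMap.range (LinearMap.pi χ) = ⊤ := by
    apply Submodule.eq_top_of_finrank_eq
    have e1 := LinearMap.finrank_range_add_finrank_ker (LinearMap.pi χ)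
    have e2 := Submodule.finrank_mono hker
    have e3 := Submodule.finrank_add_eq_of_isCompl hQ
    have e4 := Submodule.finrank_le (LinearMap.range (LinearMap.pi χ))
    simp only [Module.finrank_fin_fun] at e4 ⊢
    omega
  obtain ⟨x, hx⟩ := LinearMap.range_eq_top.mp hsurj (fun i => (i : ℂ))
  have hμ : Function.Injective (fun i : Fin r => (i : ℂ)) := fun i j h => by
    simpa [Fin.ext_iff] using h
  have hv : ∀ i : Fin r, ∃ v, (actionOnAb _ φ x).HasEigenvector (i : ℂ) v := fun i => by
    have := h2 i x
    rw [show χ i x = (i : ℂ) from congrFun hx i] at this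
    exact this.exists_hasEigenvector
  choose w hw using hv
  have hli := Module.End.eigenvectors_linearIndependent' (actionOnAb _ φ x) _ hμ w hw
  obtain ⟨b, hb⟩ : ∃ b : Module.Basis (Fin r) ℂ (LieAb N), ∀ i, b i = w i := by
    rcases Nat.eq_zero_or_pos r with h0 | h0
    · have : IsEmpty (Fin r) := by rw [h0]; infer_instance
      have : Subsingleton (LieAb N) := Module.finrank_zero_iff.mp (hr.symm.trans h0)
      exact ⟨Module.Basis.empty _, fun i => isEmptyElim i⟩
    · have : Nonempty (Fin r) := ⟨⟨0, h0⟩⟩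
      exact ⟨basisOfLinearIndependentOfCardEqFinrank hli (by simp [hr]), fun i => by simp⟩
  refine ⟨b, fun i => ?_⟩
  have hle : LinearMap.range (actionOnAb _ φ) ≤ Submodule.span ℂ (Set.range b.lineProj) := by
    rintro _ ⟨y, rfl⟩
    refine b.mem_span_lineProj_of_commute hμ (fun i => ?_) (commute_actionOnAb φ x y)
    rw [hb]
    exact (hw i).apply_eq_smul
  have hfin : FiniteDimensional ℂ (Submodule.span ℂ (Set.range b.lineProj)) :=
    FiniteDimensional.span_of_finite ℂ (Set.finite_range _)
  -- The image has dimension dim Q = r, and the diagonal matrices at most r.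
  have heq := Submodule.eq_of_le_of_finrank_le hle (by
    rw [finrank_range_actionOnAb φ hQ, hdim]
    simpa [Set.finrank] using finrank_range_le_card (R := ℂ) b.lineProj)
  rw [heq]
  exact Submodule.subset_span ⟨i, rfl⟩

theorem Module.Basis.lineProj_mul_self_mul {V ι : Type*} [AddCommGroup V] [Module ℂ V]
    (b : Module.Basis ι ℂ V) (i : ι) (X : Module.End ℂ V) :
    b.lineProj i * X * b.lineProj i = b.coord i (X (b i)) • b.lineProj i := by
  ext v
  rw [b.lineProj_mul_mul, LinearMap.smul_apply, b.lineProj_apply, smul_smul, mul_comm]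

/-- The endomorphisms of `N / [N, N]` induced by derivations, as an associative algebra: this is
possible as soon as they include all the diagonal ones. -/
theorem exists_subalgebra_eq_range_onAb {N ι : Type*} [LieRing N] [LieAlgebra ℂ N] [Fintype ι]
    (b : Module.Basis ι ℂ (LieAb N))
    (hb : ∀ i, b.lineProj i ∈ LinearMap.range (LieDerivation.onAb (N := N))) :
    ∃ A : Subalgebra ℂ (Module.End ℂ (LieAb N)),
      ∀ X, X ∈ A ↔ X ∈ LinearMap.range (LieDerivation.onAb (N := N)) := by
  classical
  refine ⟨Submodule.toSubalgebra (LinearMap.range LieDerivation.onAb) ?_ ?_, fun X => Iff.rfl⟩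
  · rw [← b.sum_lineProj]
    exact sum_mem fun i _ => hb i
  · intro X Y hX hY
    refine mul_mem_of_commutator_mem b.lineProj (fun i => ?_) (fun i j hij => ?_) b.sum_lineProj
      (fun i X => ⟨_, b.lineProj_mul_self_mul i X⟩) _ hb ?_ hX hY
    · have := b.lineProj_mul_self_mul i 1
      simpa using this
    · refine LinearMap.ext fun v => ?_
      have := b.lineProj_mul_mul i j 1 v
      simpa [hij.symm, hij] using this
    · rintro _ ⟨D, rfl⟩ _ ⟨E, rfl⟩
      exact ⟨⁅D, E⁆, LieDerivation.onAb_lie D E⟩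

end MaximalRank

/-! ### Operators scalar on the summands of a decomposition -/

section Scaling
open Polynomial
variable {V : Type*} [AddCommGroup V] [Module ℂ V] {ι : Type*} {W : ι → Submodule ℂ V}

/-- Given a direct sum decomposition, there is an endomorphism acting by prescribed scalars on
the summands. -/
theorem exists_end_forall_eq_smul (hind : iSupIndep W) (htop : ⨆ i, W i = ⊤) (c : ι → ℂ) :
    ∃ E : Module.End ℂ V, ∀ i, ∀ x ∈ W i, E x = c i • x := by
  classical
  have h := DirectSum.isInternal_submodule_of_iSupIndep_of_iSup_eq_top hind htop
  let e := LinearEquiv.ofBijective (DirectSum.coeLinearMap W) h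
  refine ⟨(DirectSum.toModule ℂ ι V fun i => c i • (W i).subtype) ∘ₗ e.symm.toLinearMap,
    fun i x hx => ?_⟩
  have : e.symm x = DirectSum.lof ℂ ι (fun i => W i) i ⟨x, hx⟩ := by
    rw [LinearEquiv.symm_apply_eq]
    exact (DirectSum.coeLinearMap_lof W i ⟨x, hx⟩).symm
  simp [this]

theorem linearMap_ext_of_iSup_eq_top {V' : Type*} [AddCommGroup V'] [Module ℂ V']
    (htop : ⨆ i, W i = ⊤) {f g : V →ₗ[ℂ] V'} (h : ∀ i, ∀ x ∈ W i, f x = g x) : f = g := by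
  have : ⨆ i, W i ≤ LinearMap.eqLocus f g := iSup_le h
  rw [htop] at this
  exact LinearMap.ext fun x => this (Submodule.mem_top (x := x))

theorem aeval_apply_of_eq_smul {E : Module.End ℂ V} {c : ℂ} {x : V} (h : E x = c • x) (q : ℂ[X]) :
    aeval E q x = q.eval c • x := by
  rcases eq_or_ne x 0 with rfl | hx
  · simp
  · exact Module.End.aeval_apply_of_hasEigenvector ⟨Module.End.mem_eigenspace_iff.mpr h, hx⟩

theorem isSemisimple_of_iSup_eq_top [Fintype ι] [FiniteDimensional ℂ V] (htop : ⨆ i, W i = ⊤)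
    {E : Module.End ℂ V} {c : ι → ℂ} (hE : ∀ i, ∀ x ∈ W i, E x = c i • x) :
    E.IsSemisimple := by
  classical
  refine Module.End.isSemisimple_of_squarefree_aeval_eq_zero
    (p := ∏ a ∈ Finset.univ.image c, (X - C a)) ?_ ?_
  · exact (separable_prod_X_sub_C_iff'.mpr fun _ _ _ _ h => h).squarefree
  · refine linearMap_ext_of_iSup_eq_top htop fun i x hx => ?_
    rw [aeval_apply_of_eq_smul (hE i x hx), eval_prod,
      Finset.prod_eq_zero (Finset.mem_image_of_mem c (Finset.mem_univ i)) (by simp)]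
    simp

theorem exists_aeval_eq_of_iSup_eq_top [Fintype ι] (htop : ⨆ i, W i = ⊤)
    {E F : Module.End ℂ V} {c d : ι → ℂ} (hc : Function.Injective c)
    (hE : ∀ i, ∀ x ∈ W i, E x = c i • x) (hF : ∀ i, ∀ x ∈ W i, F x = d i • x) :
    ∃ q : ℂ[X], F = aeval E q := by
  classical
  refine ⟨Lagrange.interpolate Finset.univ c d, linearMap_ext_of_iSup_eq_top htop fun i x hx => ?_⟩
  rw [aeval_apply_of_eq_smul (hE i x hx),
    Lagrange.eval_interpolate_at_node d hc.injOn (Finset.mem_univ i), hF i x hx]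

end Scaling

/-! ### A torus from a Cartan subalgebra -/

section Torus
open Polynomial LieAlgebra
variable {R : Type u} [LieRing R] [LieAlgebra ℂ R]

/-- The semisimple part of the action of an element of a Cartan subalgebra is a derivation. -/
theorem apply_lie_of_forall_rootSpace {H : LieSubalgebra ℂ R} [H.IsCartanSubalgebra] {h : H}
    {E : Module.End ℂ R}
    (hE : ∀ α : LieModule.Weight ℂ H R, ∀ x ∈ rootSpace H α, E x = α h • x)
    (htop : ⨆ α : LieModule.Weight ℂ H R, (rootSpace H α).toSubmodule = ⊤) (x y : R) :
    E ⁅x, y⁆ = ⁅x, E y⁆ + ⁅E x, y⁆ := by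
  have main : ∀ α β : LieModule.Weight ℂ H R, ∀ x ∈ rootSpace H α, ∀ y ∈ rootSpace H β,
      E ⁅x, y⁆ = ⁅x, E y⁆ + ⁅E x, y⁆ := by
    intro α β x hx y hy
    rw [hE α x hx, hE β y hy, lie_smul, smul_lie, ← add_smul]
    have hxy : ⁅x, y⁆ ∈ rootSpace H (α + β : H → ℂ) :=
      lie_mem_genWeightSpace_of_mem_genWeightSpace hx hy
    -- If α + β is not a weight, the bracket is zero.
    by_cases hb : rootSpace H (α + β : H → ℂ) = ⊥
    · rw [hb, LieSubmodule.mem_bot] at hxy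
      simp [hxy]
    · rw [hE ⟨_, hb⟩ _ hxy, add_comm (β h)]
      rfl
  let B : R →ₗ[ℂ] R →ₗ[ℂ] R := (LieModule.toEnd ℂ R R : R →ₗ[ℂ] R →ₗ[ℂ] R)
  have : B.compr₂ E = B.compl₂ E + B ∘ₗ E := by
    refine linearMap_ext_of_iSup_eq_top htop fun α x hx => ?_
    refine linearMap_ext_of_iSup_eq_top htop fun β y hy => ?_
    exact main α β x hx y hy
  exact LinearMap.congr_fun₂ this x y

variable [FiniteDimensional ℂ R]

/-- On the root space of α the difference is ad h − α(h), nilpotent by definition of a generalized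
weight space. -/
theorem isNilpotent_ad_sub_of_forall_rootSpace {H : LieSubalgebra ℂ R} [H.IsCartanSubalgebra] {h : H}
    {E : Module.End ℂ R}
    (hE : ∀ α : LieModule.Weight ℂ H R, ∀ x ∈ rootSpace H α, E x = α h • x)
    (htop : ⨆ α : LieModule.Weight ℂ H R, (rootSpace H α).toSubmodule = ⊤) :
    IsNilpotent (ad ℂ R (h : R) - E) := by
  rw [Module.End.isNilpotent_iff_of_finite]
  set f := ad ℂ R (h : R) - E with hf
  have hle : ⨆ α : LieModule.Weight ℂ H R, (rootSpace H α).toSubmodule ≤ f.maxGenEigenspace 0 := by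
    refine iSup_le fun α x hx => ?_
    obtain ⟨k, hk⟩ := (LieModule.mem_genWeightSpace R _ _).mp hx h
    rw [Module.End.mem_maxGenEigenspace]
    refine ⟨k, ?_⟩
    rw [zero_smul, sub_zero]
    suffices ∀ j : ℕ, (f ^ j) x = ((LieModule.toEnd ℂ H R h - α h • (1 : Module.End ℂ R)) ^ j) x ∧
        (f ^ j) x ∈ rootSpace H α by rw [(this k).1]; exact hk
    intro j
    induction j with
    | zero => exact ⟨rfl, hx⟩
    | succ j ih =>
      have e : (f ^ (j + 1)) x = ⁅h, (f ^ j) x⁆ - α h • (f ^ j) x := by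
        rw [pow_succ', Module.End.mul_apply]
        nth_rewrite 1 [hf]
        rw [LinearMap.sub_apply, hE α _ ih.2]
        rfl
      refine ⟨?_, ?_⟩
      · rw [e, pow_succ', Module.End.mul_apply, ← ih.1]
        simp
      · rw [e]
        exact sub_mem ((rootSpace H α).lie_mem ih.2) ((rootSpace H α).smul_mem _ ih.2)
  intro x
  have hx := hle (htop ▸ Submodule.mem_top (x := x))
  rw [Module.End.mem_maxGenEigenspace] at hx
  simpa using hx

variable [IsSolvable R]

/-- Modulo the nilradical ad h vanishes, so (ad h − α(h))ᵏ x = 0 reads (−α(h))ᵏ x ≡ 0, with α(h) ≠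
0. -/
theorem rootSpace_le_lieNilradical {H : LieSubalgebra ℂ R} [H.IsCartanSubalgebra] {α : H → ℂ}
    (hα : α ≠ 0) {x : R} (hx : x ∈ rootSpace H α) : x ∈ lieNilradical R := by
  obtain ⟨h, hh⟩ := Function.ne_iff.mp hα
  obtain ⟨k, hk⟩ := (LieModule.mem_genWeightSpace R _ _).mp hx h
  have : ∀ j : ℕ, ((LieModule.toEnd ℂ H R h - α h • (1 : Module.End ℂ R)) ^ j) x -
      (-α h) ^ j • x ∈ lieNilradical R := by
    intro j
    induction j with
    | zero => simp
    | succ j ih =>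
      rw [pow_succ', Module.End.mul_apply]
      set z := ((LieModule.toEnd ℂ H R h - α h • (1 : Module.End ℂ R)) ^ j) x
      have e : (LieModule.toEnd ℂ H R h - α h • (1 : Module.End ℂ R)) z - (-α h) ^ (j + 1) • x =
          ⁅(h : R), z⁆ + (-α h) • (z - (-α h) ^ j • x) := by
        rw [LinearMap.sub_apply, LinearMap.smul_apply, Module.End.one_apply, smul_sub, smul_smul,
          pow_succ', neg_smul]
        change ⁅(h : R), z⁆ - _ - _ = _
        abel
      rw [e]
      exact add_mem (lie_mem_lieNilradical _ _) ((lieNilradical R).smul_mem _ ih)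
  have h1 := this k
  have hne : (-α h) ^ k ≠ 0 := pow_ne_zero _ (neg_ne_zero.mpr hh)
  rw [hk, zero_sub, neg_mem_iff] at h1
  have h2 := (lieNilradical R).smul_mem (((-α h) ^ k)⁻¹) h1
  rwa [smul_smul, inv_mul_cancel₀ hne, one_smul] at h2

/-- A solvable Lie algebra all of whose derivations are inner is the sum of its nilradical and an
abelian subalgebra acting diagonalizably. -/
theorem exists_torus_of_forall_inner
    (hinner : ∀ D : LieDerivation ℂ R R, ∃ x : R, D = LieDerivation.ad ℂ R x) :
    ∃ (t : R) (T : Submodule ℂ R), (ad ℂ R t).IsSemisimple ∧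
      (∀ x ∈ T, ∀ y ∈ T, ⁅x, y⁆ = 0) ∧ (lieNilradical R).toSubmodule ⊔ T = ⊤ ∧
      ∀ x ∈ T, ∃ q : ℂ[X], ad ℂ R x = aeval (ad ℂ R t) q := by
  obtain ⟨x₀, hx₀⟩ := exists_isCartanSubalgebra_engel ℂ R
  generalize LieSubalgebra.engel ℂ x₀ = H at hx₀
  have htop : ⨆ α : LieModule.Weight ℂ H R, (rootSpace H α).toSubmodule = ⊤ := by
    rw [← LieSubmodule.iSup_toSubmodule, LieModule.iSup_genWeightSpace_eq_top',
      LieSubmodule.top_toSubmodule]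
  have hind : iSupIndep fun α : LieModule.Weight ℂ H R => (rootSpace H α).toSubmodule :=
    LieSubmodule.iSupIndep_toSubmodule.mpr (LieModule.iSupIndep_genWeightSpace' ℂ H R)
  have hEx : ∀ h : H, ∃ E : Module.End ℂ R,
      ∀ α : LieModule.Weight ℂ H R, ∀ x ∈ rootSpace H α, E x = α h • x := fun h =>
    exists_end_forall_eq_smul hind htop fun α => α h
  choose E hE using hEx
  have hs : ∀ h, ∃ x, ad ℂ R x = E h := by
    intro h
    obtain ⟨x, hx⟩ := hinner
      { E h with
        leibniz' := fun x y => by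
          have := apply_lie_of_forall_rootSpace (hE h) htop x y
          rw [← lie_skew (E h x) y, ← sub_eq_add_neg] at this
          exact this }
    refine ⟨x, ?_⟩
    ext y
    have := DFunLike.congr_fun hx y
    rw [LieDerivation.ad_apply_apply] at this
    exact this.symm
  choose s hs using hs
  have hzero : ∀ h, ∀ z ∈ rootSpace H (0 : H → ℂ), E h z = 0 := by
    intro h z hz
    by_cases hb : rootSpace H (0 : H → ℂ) = ⊥
    · rw [hb, LieSubmodule.mem_bot] at hz
      simp [hz]
    · rw [hE h ⟨0, hb⟩ z hz]
      exact zero_smul _ _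
  have hH : ∀ z, z ∈ rootSpace H (0 : H → ℂ) ↔ z ∈ H := fun z => by
    rw [rootSpace_zero_eq]; rfl
  let T : Submodule ℂ R :=
    { carrier := {x | ∃ h, ad ℂ R x = E h}
      add_mem' := by
        rintro x y ⟨h, hx⟩ ⟨k, hy⟩
        refine ⟨h + k, linearMap_ext_of_iSup_eq_top htop fun α z hz => ?_⟩
        rw [map_add, hx, hy, LinearMap.add_apply, hE _ α z hz, hE _ α z hz, hE _ α z hz,
          map_add, add_smul]
      zero_mem' := by
        refine ⟨0, linearMap_ext_of_iSup_eq_top htop fun α z hz => ?_⟩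
        rw [hE _ α z hz, map_zero, map_zero, zero_smul, LinearMap.zero_apply]
      smul_mem' := by
        rintro c x ⟨h, hx⟩
        refine ⟨c • h, linearMap_ext_of_iSup_eq_top htop fun α z hz => ?_⟩
        rw [map_smul, hx, LinearMap.smul_apply, hE _ α z hz, hE _ α z hz, map_smul, smul_smul,
          smul_eq_mul] }
  -- An element separating the finitely many weights; by interpolation every `E h` is a polynomial
  -- in `E h₀`.
  obtain ⟨h₀, hh₀⟩ : ∃ h₀ : H, Function.Injective fun α : LieModule.Weight ℂ H R => α h₀ := by
    obtain ⟨h₀, hh₀⟩ := Module.Dual.exists_forall_ne_zero_of_forall_exists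
      (fun p : {p : LieModule.Weight ℂ H R × LieModule.Weight ℂ H R // p.1 ≠ p.2} =>
        (LieModule.Weight.toLinear ℂ H R p.1.1 - LieModule.Weight.toLinear ℂ H R p.1.2 :
          Module.Dual ℂ H)) (by
        rintro ⟨⟨α, β⟩, hne⟩
        by_contra! hall
        refine hne (LieModule.Weight.ext fun x => ?_)
        have := hall x
        simpa [sub_eq_zero] using this)
    refine ⟨h₀, fun α β hαβ => ?_⟩
    by_contra hne
    refine hh₀ ⟨(α, β), hne⟩ ?_
    simpa [sub_eq_zero] using hαβ
  refine ⟨s h₀, T, ?_, ?_, ?_, ?_⟩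
  · rw [hs]
    exact isSemisimple_of_iSup_eq_top htop (hE h₀)
  · rintro x ⟨h, hx⟩ y ⟨k, hy⟩
    -- ad y = `E k` kills H, so y commutes with H and lies in the zero root space, which every `E h`
    -- kills.
    have : y ∈ rootSpace H (0 : H → ℂ) := by
      rw [LieModule.mem_genWeightSpace]
      refine fun z => ⟨1, ?_⟩
      have h1 : ⁅y, (z : R)⁆ = 0 := by
        rw [← ad_apply ℂ, hy]
        exact hzero k z ((hH z).mpr z.2)
      have h2 : ⁅(z : R), y⁆ = 0 := by rw [← lie_skew, h1, neg_zero]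
      simpa using h2
    rw [← ad_apply ℂ, hx]
    exact hzero h y this
  · rw [eq_top_iff, ← htop]
    refine iSup_le fun α x hx => ?_
    by_cases hα : (α : H → ℂ) = 0
    · rw [LieSubmodule.mem_toSubmodule, hα, hH] at hx
      have h1 : x - s ⟨x, hx⟩ ∈ lieNilradical R := by
        rw [mem_lieNilradical_iff, map_sub, hs]
        exact isNilpotent_ad_sub_of_forall_rootSpace (hE ⟨x, hx⟩) htop
      rw [← sub_add_cancel x (s ⟨x, hx⟩)]
      exact Submodule.add_mem_sup h1 ⟨_, hs _⟩
    · exact Submodule.mem_sup_left (rootSpace_le_lieNilradical hα hx)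
  · rintro x ⟨h, hx⟩
    rw [hx, hs]
    exact exists_aeval_eq_of_iSup_eq_top htop hh₀ (hE h₀) (hE h)

end Torus

/-! ### Polynomials and semisimplicity under intertwining maps -/

section Intertwining
open Polynomial

theorem apply_aeval_of_intertwine {V W : Type*} [AddCommGroup V] [Module ℂ V] [AddCommGroup W]
    [Module ℂ W] {f : V →ₗ[ℂ] W} {a : Module.End ℂ V} {b : Module.End ℂ W}
    (h : ∀ x, f (a x) = b (f x)) (q : ℂ[X]) (x : V) : f (aeval a q x) = aeval b q (f x) := by
  induction q using Polynomial.induction_on' with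
  | add p q hp hq => simp [hp, hq]
  | monomial n c =>
    have : ∀ n : ℕ, f ((a ^ n) x) = (b ^ n) (f x) := by
      intro n
      induction n with
      | zero => simp
      | succ n ih => rw [pow_succ', pow_succ', Module.End.mul_apply, Module.End.mul_apply, h, ih]
    simp [aeval_monomial, Module.algebraMap_end_apply, this]

/-- The squarefree minimal polynomial of `b` also annihilates `a`. -/
theorem Module.End.IsSemisimple.of_injective {V W : Type*} [AddCommGroup V] [Module ℂ V]
    [AddCommGroup W] [Module ℂ W] [FiniteDimensional ℂ W] {f : V →ₗ[ℂ] W} {a : Module.End ℂ V}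
    {b : Module.End ℂ W} (hb : b.IsSemisimple) (hf : Function.Injective f)
    (h : ∀ x, f (a x) = b (f x)) : a.IsSemisimple := by
  refine Module.End.isSemisimple_of_squarefree_aeval_eq_zero hb.minpoly_squarefree ?_
  refine LinearMap.ext fun x => hf ?_
  rw [apply_aeval_of_intertwine h, minpoly.aeval]
  simp

theorem Module.End.IsSemisimple.of_surjective {V W : Type*} [AddCommGroup V] [Module ℂ V]
    [AddCommGroup W] [Module ℂ W] [FiniteDimensional ℂ V] {f : V →ₗ[ℂ] W} {a : Module.End ℂ V}
    {b : Module.End ℂ W} (ha : a.IsSemisimple) (hf : Function.Surjective f)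
    (h : ∀ x, f (a x) = b (f x)) : b.IsSemisimple := by
  refine Module.End.isSemisimple_of_squarefree_aeval_eq_zero ha.minpoly_squarefree ?_
  refine LinearMap.ext fun y => ?_
  obtain ⟨x, rfl⟩ := hf y
  rw [← apply_aeval_of_intertwine h, minpoly.aeval]
  simp

end Intertwining

/-! ### Lifting to derivations commuting with a semisimple one -/

section Lifting
variable {N : Type u} [LieRing N] [LieAlgebra ℂ N] [FiniteDimensional ℂ N]

/-- The commutator with a semisimple derivation is semisimple on derivations. -/
theorem isSemisimple_ad_lieDerivation {d : LieDerivation ℂ N N}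
    (hd : Module.End.IsSemisimple (d : N →ₗ[ℂ] N)) :
    Module.End.IsSemisimple (LieAlgebra.ad ℂ (LieDerivation ℂ N N) d) := by
  have h := LieAlgebra.ad_isSemisimple_of_isSemisimple hd
  rw [LieAlgebra.ad_eq_lmul_left_sub_lmul_right] at h
  let f : LieDerivation ℂ N N →ₗ[ℂ] Module.End ℂ N :=
    { toFun := fun D => (D : N →ₗ[ℂ] N)
      map_add' := fun _ _ => rfl
      map_smul' := fun _ _ => rfl }
  refine Module.End.IsSemisimple.of_injective h (f := f) (fun D E hDE => ?_) fun D => ?_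
  · ext x
    exact LinearMap.congr_fun hDE x
  · ext x
    change ⁅d, D⁆ x = d (D x) - D (d x)
    rw [LieDerivation.commutator_apply]

/-- An endomorphism of `N / [N, N]` induced by some derivation and commuting with the one induced
by a semisimple derivation `d` is induced by a derivation commuting with `d`. -/
theorem exists_onAb_eq_of_commute {d : LieDerivation ℂ N N}
    (hd : Module.End.IsSemisimple (d : N →ₗ[ℂ] N)) (D : LieDerivation ℂ N N)
    (hD : Commute (LieDerivation.onAb D) (LieDerivation.onAb d)) :
    ∃ E : LieDerivation ℂ N N, LieDerivation.onAb E = LieDerivation.onAb D ∧ ⁅d, E⁆ = 0 := by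
  have hss := isSemisimple_ad_lieDerivation hd
  rw [Module.End.isSemisimple_iff] at hss
  have hinv : ∀ E, LieDerivation.onAb E = 0 → LieDerivation.onAb ⁅d, E⁆ = 0 := fun E hE => by
    rw [LieDerivation.onAb_lie, hE, mul_zero, zero_mul, sub_zero]
  -- E will be the component of D in an ad d-stable complement W of the kernel; then ⁅d, E⁆ lies
  -- both in W and in the kernel.
  obtain ⟨W, hW, hcompl⟩ := hss (LinearMap.ker (LieDerivation.onAb (N := N)))
    (fun E hE => LinearMap.mem_ker.mpr (hinv E (LinearMap.mem_ker.mp hE)))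
  obtain ⟨E', hE', E, hE, rfl⟩ := Submodule.mem_sup.mp
    (hcompl.sup_eq_top ▸ Submodule.mem_top (x := D))
  rw [LinearMap.mem_ker] at hE'
  refine ⟨E, by rw [map_add, hE', zero_add], ?_⟩
  have h1 : ⁅d, E⁆ ∈ W := hW hE
  have h2 : LieDerivation.onAb ⁅d, E⁆ = 0 := by
    rw [map_add, hE', zero_add] at hD
    rw [LieDerivation.onAb_lie, sub_eq_zero]
    exact hD.eq.symm
  exact (Submodule.disjoint_def.mp hcompl.disjoint) _ (LinearMap.mem_ker.mpr h2) h1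

end Lifting

/-! ### Extending derivations from an ideal -/

section Extension
variable {R : Type u} [LieRing R] [LieAlgebra ℂ R]

/-- A derivation of an ideal commuting with an abelian complement extends by zero. -/
theorem exists_lieDerivation_extending (I : LieIdeal ℂ R) {Q : Submodule ℂ R}
    (hQ : IsCompl I.toSubmodule Q) (hab : ∀ x ∈ Q, ∀ y ∈ Q, ⁅x, y⁆ = 0) (E : LieDerivation ℂ I I)
    (hE : ∀ x ∈ Q, ∀ n : I, E ⁅x, n⁆ = ⁅x, E n⁆) :
    ∃ D : LieDerivation ℂ R R, ∀ n : I, D n = E n := by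
  let π : R →ₗ[ℂ] I := Submodule.projectionOnto I.toSubmodule Q hQ
  have hπ : ∀ n : I, π n = n := fun n => Submodule.projectionOnto_apply_left hQ n
  have hπQ : ∀ x ∈ Q, π x = 0 := fun x hx =>
    (Submodule.projectionOnto_apply_eq_zero_iff hQ).mpr hx
  let ℓ : R →ₗ[ℂ] R := I.toSubmodule.subtype ∘ₗ (E : I →ₗ[ℂ] I) ∘ₗ π
  have hℓ : ∀ n : I, ℓ n = E n := fun n => by simp [ℓ, hπ]
  have hℓQ : ∀ x ∈ Q, ℓ x = 0 := fun x hx => by simp [ℓ, hπQ x hx]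
  have hdec : ∀ x, ∃ n : I, ∃ q ∈ Q, x = n + q := fun x => by
    obtain ⟨n, hn, q, hq, h⟩ := Submodule.mem_sup.mp
      (hQ.sup_eq_top ▸ Submodule.mem_top (x := x))
    exact ⟨⟨n, hn⟩, q, hq, h.symm⟩
  refine ⟨{ ℓ with leibniz' := fun x y => ?_ }, hℓ⟩
  change ℓ ⁅x, y⁆ = ⁅x, ℓ y⁆ - ⁅y, ℓ x⁆
  obtain ⟨n, q, hq, rfl⟩ := hdec x
  obtain ⟨m, p, hp, rfl⟩ := hdec y
  have h1 : ℓ ⁅(n : R), (m : R)⁆ = ⁅(n : R), (E m : R)⁆ - ⁅(m : R), (E n : R)⁆ := by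
    have := hℓ ⁅n, m⁆
    rw [E.apply_lie_eq_sub] at this
    simpa using this
  have h2 : ∀ x ∈ Q, ∀ k : I, ℓ ⁅x, (k : R)⁆ = ⁅x, (E k : R)⁆ := fun x hx k => by
    have := hℓ ⁅x, k⁆
    rw [hE x hx] at this
    simpa using this
  rw [map_add, map_add, hℓ, hℓ, hℓQ q hq, hℓQ p hp, add_zero, add_zero, add_lie, lie_add, lie_add,
    hab q hq p hp, ← lie_skew (n : R) p, map_add, map_add, map_add, map_neg, h1, h2 p hp, h2 q hq,
    map_zero, add_lie, add_lie]
  abel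

end Extension

/-! ### The main theorem -/

open Polynomial in
theorem mainTheorem1 (R : Type u) [LieRing R] [LieAlgebra ℂ R] [FiniteDimensional ℂ R]
    [LieAlgebra.IsSolvable R] (hN : HasMaximalRank.{u, v} (lieNilradical R))
    (Q : Submodule ℂ R) (hQ : IsCompl (lieNilradical R).toSubmodule Q)
    (hdim : Module.finrank ℂ Q < dimModSquare (lieNilradical R)) :
    ∃ D : LieDerivation ℂ R R, ∀ x : R, D ≠ LieDerivation.ad ℂ R x := by
  by_contra! hinner
  let N := lieNilradical R
  have hfinN : FiniteDimensional ℂ N := inferInstanceAs (FiniteDimensional ℂ N.toSubmodule)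
  obtain ⟨S, _, _, _, _, ⟨φ⟩, QS, hQS, hdimS⟩ := hN
  obtain ⟨b, hb⟩ := exists_basis_lineProj_mem_range φ hQS hdimS
  have hbAb : ∀ i, b.lineProj i ∈ LinearMap.range (LieDerivation.onAb (N := N)) := fun i =>
    LinearMap.range_comp_le_range _ _ (hb i)
  obtain ⟨A, hA⟩ := exists_subalgebra_eq_range_onAb b hbAb
  obtain ⟨t, T, ht, hab, hsup, hpoly⟩ := exists_torus_of_forall_inner hinner
  let δ := derivationOfIdeal N (LieEquiv.refl : N ≃ₗ⁅ℂ⁆ N)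
  let ρ := actionOnAb N (LieEquiv.refl : N ≃ₗ⁅ℂ⁆ N)
  have hδ : ∀ x (n : N), (δ x n : R) = ⁅x, (n : R)⁆ := coe_derivationOfIdeal N LieEquiv.refl
  have hρ : ∀ x, ρ x = LieDerivation.onAb (δ x) := fun x => rfl
  have hint : ∀ x (n : N), N.toSubmodule.subtype ((δ x : N →ₗ[ℂ] N) n) =
      LieAlgebra.ad ℂ R x (N.toSubmodule.subtype n) := hδ
  have hδt : Module.End.IsSemisimple (δ t : N →ₗ[ℂ] N) :=
    Module.End.IsSemisimple.of_injective ht N.toSubmodule.injective_subtype (hint t)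
  have hρt : (ρ t).IsSemisimple :=
    Module.End.IsSemisimple.of_surjective hδt (Submodule.mkQ_surjective _) fun _ => rfl
  have hδpoly : ∀ x ∈ T, ∃ q : ℂ[X], (δ x : N →ₗ[ℂ] N) = aeval (δ t : Module.End ℂ N) q := by
    intro x hx
    obtain ⟨q, hq⟩ := hpoly x hx
    refine ⟨q, LinearMap.ext fun n => N.toSubmodule.injective_subtype ?_⟩
    rw [hint, apply_aeval_of_intertwine (hint t), hq]
  have hU : ∀ X ∈ LinearMap.range ρ, ∃ q : ℂ[X], aeval (ρ t) q = X := by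
    rintro _ ⟨x, rfl⟩
    obtain ⟨n, hn, y, hy, rfl⟩ := Submodule.mem_sup.mp (hsup ▸ Submodule.mem_top (x := x))
    obtain ⟨q, hq⟩ := hδpoly y hy
    refine ⟨q, ?_⟩
    rw [map_add, show ρ n = 0 from actionOnAb_eq_zero_of_mem N _ hn, zero_add]
    refine LinearMap.ext fun v => ?_
    obtain ⟨m, rfl⟩ := Submodule.mkQ_surjective _ v
    rw [← apply_aeval_of_intertwine (f := Submodule.mkQ _) (a := (δ t : Module.End ℂ N))
      (fun _ => rfl), ← hq]
    rfl
  obtain ⟨X, hXA, hXt, hXU⟩ := exists_commute_notMem b A (fun i => (hA _).mpr (hbAb i))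
    ((hA _).mpr ⟨δ t, rfl⟩) hρt (LinearMap.range ρ) hU
    (by rw [finrank_range_actionOnAb _ hQ]; exact hdim)
  obtain ⟨D', rfl⟩ := (hA X).mp hXA
  obtain ⟨E, hE, hEt⟩ := exists_onAb_eq_of_commute hδt D' hXt
  have hcomm : Commute (E : Module.End ℂ N) (δ t : Module.End ℂ N) := by
    refine LinearMap.ext fun n => ?_
    have := DFunLike.congr_fun hEt n
    rw [LieDerivation.commutator_apply] at this
    exact (sub_eq_zero.mp this).symm
  -- The given Q need not be abelian and serves only to count dimensions; a complement inside T is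
  -- abelian, and E commutes with its action.
  obtain ⟨Q', hQ'T, hQ'⟩ := (codisjoint_iff.mpr hsup).symm.exists_isCompl
  obtain ⟨D, hD⟩ := exists_lieDerivation_extending N hQ'.symm
    (fun x hx y hy => hab x (hQ'T hx) y (hQ'T hy)) E fun x hx n => by
      obtain ⟨q, hq⟩ := hδpoly x (hQ'T hx)
      have h1 : Commute (E : Module.End ℂ N) (δ x : N →ₗ[ℂ] N) := by
        rw [hq]
        exact Algebra.commute_of_mem_adjoin_singleton_of_commute
          (aeval_mem_adjoin_singleton ℂ _) hcomm
      exact LinearMap.congr_fun h1.eq n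
  obtain ⟨x, hx⟩ := hinner D
  refine hXU ⟨x, ?_⟩
  rw [← hE, hρ]
  congr 1
  ext n
  rw [← hD, hx, hδ]
  simp
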